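/- Let $k$ be a field and let $f : X \to Y$ be a birational morphism of normal projective varieties over $k$ (integral projective $k$-schemes whose local rings are integrally closed). Write $\mathrm{Cl}$ for the group of Weil divisors modulo principal divisors and $[D]$ for the class of a divisor $D$. A prime divisor $E$ of $X$ is called exceptional if $f(E)$ has codimension at least two in $Y$; write $f_*$ for the pushforward of divisors, which kills the exceptional prime divisors. A class is effective if it contains a divisor with non-negative coefficients. The effective cone of $X$ is the set of all non-negative real linear combinations of classes of prime divisors in $\mathrm{Cl}(X) \otimes_{\mathbb{Z}} \mathbb{R}$, and a hole is a class in $\mathrm{Cl}(X)$ whose image lies in the effective cone but which is not effective. Then: 1. There are only finitely many exceptional prime divisors $E_1, \dots, E_n$, and their classes are linearly independent over $\mathbb{Z}$, so that they generate a subgroup $H = \bigoplus_{i} \mathbb{Z}[E_i] \subset \mathrm{Cl}(X)$. 2. The pushforward induces an isomorphism $\mathrm{Cl}(X)/H \cong \mathrm{Cl}(Y)$, $[D] + H \mapsto [f_* D]$. 3. If $H$ is not saturated (that is, if there are a class $c \notin H$ and an integer $m \geq 1$ with $mc \in H$), then $\mathrm{Cl}(Y)$ has a nonzero torsion element. 4.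 If $[D] \in \mathrm{Cl}(X)$ is a class with $[D] \notin H$ and $m[D] \in H$ for some integer $m \geq 1$, then $[D]$ is not effective, and $[f_* D]$ is a nonzero torsion element of $\mathrm{Cl}(Y)$. 5. If $[D] \in \mathrm{Cl}(X)$ is a class with $[D] \notin H$ such that $m[D] = \sum_i a_i [E_i]$ for some integer $m \geq 1$ and integers $a_i \geq 0$, then $[D]$ is a hole. -/

import Mathlib

open CategoryTheory AlgebraicGeometry
open scoped TensorProduct

universe u

noncomputable section

namespace TorsionHoles

/-! ### Normal projective varieties over a field -/

attribute [local instance] MvPolynomial.gradedAlgebra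

/-- The standard grading of `k[x₀, …, xₙ]`. -/
abbrev stdGrading (k : Type u) [Field k] (n : ℕ) : ℕ → Submodule k (MvPolynomial (Fin (n + 1)) k) :=
  MvPolynomial.homogeneousSubmodule (Fin (n + 1)) k

/-- Projective `n`-space over `k`. -/
def projSpace (k : Type u) [Field k] (n : ℕ) : Scheme.{u} :=
  Proj (stdGrading k n)

/-- The structure morphism of projective `n`-space over `k`. -/
def projSpaceHom (k : Type u) [Field k] (n : ℕ) : projSpace k n ⟶ Spec (CommRingCat.of k) :=
  Proj.toSpecZero (stdGrading k n) ≫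
    Spec.map (CommRingCat.ofHom (algebraMap k (stdGrading k n 0)))

/-- A `k`-scheme is projective if it is a closed subscheme of some projective space over `k`. -/
def IsProjectiveOver {k : Type u} [Field k] {X : Scheme.{u}} (s : X ⟶ Spec (CommRingCat.of k)) :
    Prop :=
  ∃ (n : ℕ) (i : X ⟶ projSpace k n), IsClosedImmersion i ∧ i ≫ projSpaceHom k n = s

theorem projSpaceHom_locallyOfFiniteType (k : Type u) [Field k] (n : ℕ) :
    LocallyOfFiniteType (projSpaceHom k n) := by
  have h0 : IsScalarTower k (stdGrading k n 0) (MvPolynomial (Fin (n + 1)) k) :=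
    ⟨fun a b c => smul_assoc a (b : MvPolynomial (Fin (n + 1)) k) c⟩
  have h1 : Algebra.FiniteType (stdGrading k n 0) (MvPolynomial (Fin (n + 1)) k) :=
    Algebra.FiniteType.of_restrictScalars_finiteType k _ _
  have h2 : (algebraMap k (stdGrading k n 0)).FiniteType := by
    apply RingHom.FiniteType.of_surjective
    rintro ⟨p, hp⟩
    have hp' : p.IsHomogeneous 0 := hp
    have := (MvPolynomial.totalDegree_eq_zero_iff_eq_C).1 (Nat.le_zero.1 hp'.totalDegree_le)
    exact ⟨p.coeff 0, Subtype.ext this.symm⟩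
  have h3 : LocallyOfFiniteType
      (Spec.map (CommRingCat.ofHom (algebraMap k (stdGrading k n 0)))) :=
    (HasRingHomProperty.Spec_iff (P := @LocallyOfFiniteType)).2 h2
  unfold projSpaceHom projSpace
  infer_instance

theorem IsProjectiveOver.isLocallyNoetherian {k : Type u} [Field k] {X : Scheme.{u}}
    {s : X ⟶ Spec (CommRingCat.of k)} (h : IsProjectiveOver s) : IsLocallyNoetherian X := by
  obtain ⟨n, i, hi, rfl⟩ := h
  have := projSpaceHom_locallyOfFiniteType k n
  exact LocallyOfFiniteType.isLocallyNoetherian (i ≫ projSpaceHom k n)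

/-- A normal projective variety over a field `k`: an integral projective `k`-scheme all of whose
local rings are integrally closed domains. -/
structure NormalProjectiveVariety (k : Type u) [Field k] where
  /-- The underlying scheme. -/
  carrier : Scheme.{u}
  /-- The structure morphism. -/
  hom : carrier ⟶ Spec (CommRingCat.of k)
  isIntegral : IsIntegral carrier
  isNormal : ∀ x : carrier, IsIntegrallyClosed (carrier.presheaf.stalk x)
  isProjective : IsProjectiveOver hom

instance {k : Type u} [Field k] (X : NormalProjectiveVariety k) : IsIntegral X.carrier :=
  X.isIntegral

instance {k : Type u} [Field k] (X : NormalProjectiveVariety k) : IsLocallyNoetherian X.carrier :=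
  X.isProjective.isLocallyNoetherian

/-- A morphism of schemes is birational if it restricts to an isomorphism from a dense open
subscheme of the source to a dense open subscheme of the target. -/
def IsBirationalMorphism {X Y : Scheme.{u}} (f : X ⟶ Y) : Prop :=
  ∃ φ : X.PartialIso Y, φ.iso.hom ≫ φ.target.ι = φ.source.ι ≫ f

/-! ### Weil divisors and the class group -/

/-- Prime divisors, i.e. closed integral subschemes of codimension one, are represented by their
generic points, i.e. by the points of codimension one. -/
def PrimeDivisor (X : Scheme.{u}) : Type u :=
  {x : X // Order.coheight x = 1}

/-- Weil divisors: finite integral linear combinations of prime divisors. -/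
abbrev WeilDivisor (X : Scheme.{u}) : Type u :=
  PrimeDivisor X →₀ ℤ

section ClassGroup

variable (X : Scheme.{u}) [IsIntegral X] [IsLocallyNoetherian X]

/-- The subgroup of principal divisors `div g = ∑ ord_P(g) P`, for `g` a nonzero rational
function. -/
def principalDivisors : AddSubgroup (WeilDivisor X) where
  carrier := {D | ∃ g : X.functionField, g ≠ 0 ∧ ∀ P : PrimeDivisor X, D P = X.ord g P.1}
  zero_mem' := by
    refine ⟨1, one_ne_zero, fun P => ?_⟩
    have h := Scheme.ord_mul (x := P.1) (one_ne_zero (α := X.functionField)) one_ne_zero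
    rw [mul_one] at h
    simp only [Finsupp.coe_zero, Pi.zero_apply]
    omega
  add_mem' := by
    rintro D E ⟨g, hg, hD⟩ ⟨h, hh, hE⟩
    exact ⟨g * h, mul_ne_zero hg hh, fun P => by
      rw [Finsupp.add_apply, hD, hE, Scheme.ord_mul hg hh]⟩
  neg_mem' := by
    rintro D ⟨g, hg, hD⟩
    refine ⟨g⁻¹, inv_ne_zero hg, fun P => ?_⟩
    have h := Scheme.ord_mul (x := P.1) hg (inv_ne_zero hg)
    have h1 := Scheme.ord_mul (x := P.1) (one_ne_zero (α := X.functionField)) one_ne_zero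
    rw [mul_one] at h1
    rw [mul_inv_cancel₀ hg] at h
    rw [Finsupp.neg_apply, hD]
    omega

/-- The class group `Cl(X)` of Weil divisors modulo principal divisors. -/
abbrev Cl : Type u :=
  WeilDivisor X ⧸ principalDivisors X

variable {X}

/-- The class `[D]` of a divisor. -/
def divClass (D : WeilDivisor X) : Cl X :=
  QuotientAddGroup.mk D

/-- The class `[P]` of a prime divisor. -/
def primeClass (P : PrimeDivisor X) : Cl X :=
  divClass (Finsupp.single P 1)

/-- A divisor class is effective if it contains a divisor with nonnegative coefficients. -/
def IsEffectiveClass (c : Cl X) : Prop :=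
  ∃ D : WeilDivisor X, 0 ≤ D ∧ divClass D = c

variable (X) in
/-- The effective cone: all nonnegative real linear combinations of classes of prime divisors in
the real vector space `Cl(X) ⊗ ℝ`. -/
def effectiveCone : PointedCone ℝ (ℝ ⊗[ℤ] Cl X) :=
  PointedCone.hull ℝ (Set.range fun P : PrimeDivisor X => (1 : ℝ) ⊗ₜ[ℤ] primeClass P)

/-- A hole is a divisor class that lies in the effective cone but is not effective. -/
def IsHole (c : Cl X) : Prop :=
  (1 : ℝ) ⊗ₜ[ℤ] c ∈ effectiveCone X ∧ ¬ IsEffectiveClass c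

end ClassGroup

/-! ### Pushforward and exceptional divisors -/

section Pushforward

variable {X Y : Scheme.{u}} (f : X ⟶ Y)

open Classical in
/-- The pushforward of a prime divisor `P`: it is `[κ(P) : κ(f(P))] · f(P)` if `f(P)` is again a
divisor (the degree is `1` when `f` is birational), and `0` if `f(P)` is not a divisor. -/
def pushforwardPrime (P : PrimeDivisor X) : WeilDivisor Y :=
  if h : Order.coheight (f P.1) = 1 then Finsupp.single ⟨f P.1, h⟩ (f.residueDegree P.1 : ℤ) else 0

/-- The pushforward `f_* : Div(X) → Div(Y)`, extended linearly. -/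
def pushforward : WeilDivisor X →+ WeilDivisor Y :=
  Finsupp.liftAddHom fun P => zmultiplesHom _ (pushforwardPrime f P)

/-- The prime exceptional divisors of `f`: the prime divisors whose image has codimension at
least two. -/
def exceptionalPrimes : Set (PrimeDivisor X) :=
  {P | 2 ≤ Order.coheight (f P.1)}

variable [IsIntegral X] [IsLocallyNoetherian X]

/-- The subgroup of `Cl(X)` generated by the classes of the prime exceptional divisors of `f`. -/
def exceptionalSubgroup : AddSubgroup (Cl X) :=
  AddSubgroup.closure (primeClass '' exceptionalPrimes f)

end Pushforward

end TorsionHoles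

end

namespace TorsionHoles

/-! ### Algebraic preliminaries -/

section Algebra

/-- If the denominator ideal of an element `x` of the fraction field of a Noetherian integrally
closed domain is a prime `p`, then `p` has height one. -/
theorem height_eq_one_of_mem_iff_smul_mem_range {R K : Type*} [CommRing R] [IsDomain R]
    [IsNoetherianRing R] [IsIntegrallyClosed R] [Field K] [Algebra R K] [IsFractionRing R K]
    {p : Ideal R} [p.IsPrime] {x : K}
    (hp : ∀ r, r ∈ p ↔ r • x ∈ (algebraMap R K).range) : p.height = 1 := by
  have hinj := IsFractionRing.injective R K
  have hp0 : p ≠ ⊥ := by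
    rintro rfl
    obtain ⟨a, b, hb, rfl⟩ := IsFractionRing.div_surjective (A := R) x
    have hb' : algebraMap R K b ≠ 0 := by
      simpa [map_ne_zero_iff _ hinj] using nonZeroDivisors.ne_zero hb
    have : b ∈ (⊥ : Ideal R) := (hp b).2 ⟨a, by rw [Algebra.smul_def]; field_simp⟩
    exact nonZeroDivisors.ne_zero hb (by simpa using this)
  have hx : x ∉ (algebraMap R K).range := fun h =>
    Ideal.IsPrime.ne_top ‹_› ((Ideal.eq_top_iff_one p).2 ((hp 1).2 (by simpa using h)))
  have hu : ∃ t ∈ p, ∃ v, v ∉ p ∧ algebraMap R K v = t • x := by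
    by_contra! H
    refine hx ?_
    have hint : IsIntegral R x := by
      let N : Submodule R K := Submodule.map (Algebra.linearMap R K) p
      refine isIntegral_of_smul_mem_submodule (M := K) (N := N) ?_ ?_ x ?_
      · intro h0
        obtain ⟨r, hr, hr0⟩ := p.ne_bot_iff.1 hp0
        have : algebraMap R K r ∈ N := Submodule.mem_map_of_mem hr
        rw [h0, Submodule.mem_bot] at this
        exact hr0 (hinj (by simpa using this))
      · exact Submodule.FG.map _ (IsNoetherian.noetherian p)
      · rintro _ ⟨t, ht, rfl⟩
        obtain ⟨v, hv⟩ := (hp t).1 ht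
        have hvp : v ∈ p := by
          by_contra hvp
          exact H t ht v hvp hv
        refine ⟨v, hvp, ?_⟩
        simp [hv, Algebra.smul_def, mul_comm]
    obtain ⟨y, hy⟩ := IsIntegrallyClosed.isIntegral_iff.1 hint
    exact ⟨y, hy⟩
  obtain ⟨t, ht, v, hv, htv⟩ := hu
  refine le_antisymm ?_ ?_
  · refine Ideal.height_le_one_of_isPrincipal_of_mem_minimalPrimes (Ideal.span {t}) p
      ⟨⟨‹_›, by simpa [Ideal.span_le] using ht⟩, fun q hq hqp s hs => ?_⟩
    obtain ⟨hq1, hq2⟩ := hq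
    obtain ⟨w, hw⟩ := (hp s).1 hs
    have hsv : s * v = t * w := by
      apply hinj
      rw [map_mul, map_mul, hw, htv, Algebra.smul_def, Algebra.smul_def]
      ring
    have htq : t ∈ q := hq2 (Ideal.mem_span_singleton_self t)
    exact (hq1.mem_or_mem (x := s) (y := v) (hsv ▸ q.mul_mem_right w htq)).resolve_right
      fun hvq => hv (hqp hvq)
  · rw [Order.one_le_iff_ne_zero, Ne, Ideal.height_eq_zero_iff, IsDomain.minimalPrimes_eq_singleton_bot]
    exact hp0

/-- An element of the fraction field of a Noetherian integrally closed domain `R` that lies in the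
localizations at all primes of height one lies in `R`. -/
theorem mem_range_algebraMap_of_height_one {R K : Type*} [CommRing R] [IsDomain R]
    [IsNoetherianRing R] [IsIntegrallyClosed R] [Field K] [Algebra R K] [IsFractionRing R K] (x : K)
    (h : ∀ p : Ideal R, p.IsPrime → p.height = 1 → ∃ s, s ∉ p ∧ s • x ∈ (algebraMap R K).range) :
    x ∈ (algebraMap R K).range := by
  by_contra hx
  let N : Submodule R K := LinearMap.range (Algebra.linearMap R K)
  have hN (y : K) : y ∈ N ↔ y ∈ (algebraMap R K).range := Iff.rfl
  have hx0 : N.mkQ x ≠ 0 := fun h0 => hx ((Submodule.Quotient.mk_eq_zero N).1 h0)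
  let C : Submodule R (K ⧸ N) := Submodule.span R {N.mkQ x}
  obtain ⟨p, hp, -⟩ := exists_le_isAssociatedPrime_of_isNoetherianRing R
    (⟨N.mkQ x, Submodule.mem_span_singleton_self _⟩ : C) (by simpa [Subtype.ext_iff] using hx0)
  obtain ⟨hp, y, hy⟩ := isAssociatedPrime_iff.1 hp
  obtain ⟨c, hc⟩ := Submodule.mem_span_singleton.1 y.2
  have key (r : R) : r ∈ p ↔ r • (c • x) ∈ (algebraMap R K).range := by
    rw [hy]
    rw [← hN, ← Submodule.Quotient.mk_eq_zero N, Submodule.mem_colon_singleton, Submodule.mem_bot,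
      Subtype.ext_iff]
    simp [← hc]
  obtain ⟨s, hs, hsx⟩ := h p hp (height_eq_one_of_mem_iff_smul_mem_range key)
  refine hs ((key s).2 ?_)
  rw [smul_comm, ← hN]
  exact N.smul_mem c hsx

/-- A local homomorphism from a valuation ring to a domain which induces an isomorphism of fraction
fields is an isomorphism. -/
theorem bijective_of_valuationRing {A B K L : Type*} [CommRing A] [IsDomain A] [ValuationRing A]
    [Field K] [Algebra A K] [IsFractionRing A K] [CommRing B] [IsDomain B] [Field L] [Algebra B L]
    [IsFractionRing B L] (ψ : A →+* B) [IsLocalHom ψ] (φ : K →+* L) (hφ : Function.Surjective φ)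
    (h : ∀ a, φ (algebraMap A K a) = algebraMap B L (ψ a)) : Function.Bijective ψ := by
  have hinj := IsFractionRing.injective B L
  refine ⟨fun a a' haa' => IsFractionRing.injective A K (φ.injective (by rw [h, h, haa'])),
    fun b => ?_⟩
  obtain ⟨x, hx⟩ := hφ (algebraMap B L b)
  rcases ValuationRing.isInteger_or_isInteger A x with ⟨a, rfl⟩ | ⟨a, ha⟩
  · exact ⟨a, hinj (by rw [← h, hx])⟩
  · by_cases hx0 : x = 0
    · exact ⟨0, hinj (by rw [map_zero, ← hx, hx0, map_zero, map_zero])⟩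
    have hab : ψ a * b = 1 := by
      apply hinj
      rw [map_mul, ← h, ha, ← hx, ← map_mul, inv_mul_cancel₀ hx0, map_one, map_one]
    obtain ⟨u, rfl⟩ := isUnit_of_map_unit ψ a (.of_mul_eq_one b hab)
    refine ⟨↑u⁻¹, ?_⟩
    rw [← mul_one (ψ _), ← hab, ← mul_assoc, ← map_mul, Units.inv_mul, map_one, one_mul]

/-- The order of vanishing on a discrete valuation ring is invariant under isomorphisms. -/
theorem ordFrac_map_of_bijective {A B K L : Type*} [CommRing A] [IsDomain A]
    [IsDiscreteValuationRing A] [Field K] [Algebra A K] [IsFractionRing A K]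
    [CommRing B] [IsDomain B] [IsNoetherianRing B] [Ring.KrullDimLE 1 B]
    [Field L] [Algebra B L] [IsFractionRing B L]
    (ψ : A →+* B) (hψ : Function.Bijective ψ) (φ : K →+* L)
    (h : ∀ a, φ (algebraMap A K a) = algebraMap B L (ψ a)) (x : K) :
    Ring.ordFrac B (φ x) = Ring.ordFrac A x := by
  let e : A ≃+* B := RingEquiv.ofBijective ψ hψ
  have : IsDiscreteValuationRing B := IsDiscreteValuationRing.RingEquivClass.isDiscreteValuationRing e
  obtain ⟨ϖ, hϖ⟩ := IsDiscreteValuationRing.exists_irreducible A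
  have hϖ' : Irreducible (ψ ϖ) := (MulEquiv.irreducible_iff e).2 hϖ
  have key (a : A) : Ring.ordFrac B (algebraMap B L (ψ a)) = Ring.ordFrac A (algebraMap A K a) := by
    by_cases ha : a = 0
    · simp [ha]
    obtain ⟨n, u, rfl⟩ := IsDiscreteValuationRing.eq_unit_mul_pow_irreducible ha hϖ
    simp only [map_mul, map_pow, Ring.ordFrac_irreducible hϖ', Ring.ordFrac_irreducible hϖ,
      Ring.ordFrac_of_isUnit u.isUnit, Ring.ordFrac_of_isUnit (u.isUnit.map ψ)]
  obtain ⟨a, b, -, rfl⟩ := IsFractionRing.div_surjective (A := A) x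
  rw [map_div₀, map_div₀, map_div₀, h, h, key, key]

/-- An element of nonnegative order lies in the discrete valuation ring. -/
theorem mem_range_of_one_le_ordFrac {A K : Type*} [CommRing A] [IsDomain A]
    [IsDiscreteValuationRing A] [Field K] [Algebra A K] [IsFractionRing A K] {x : K}
    (h : 1 ≤ Ring.ordFrac A x) : x ∈ (algebraMap A K).range := by
  rcases ValuationRing.isInteger_or_isInteger A x with hx | ⟨a, ha⟩
  · exact hx
  have hx0 : x ≠ 0 := by
    rintro rfl
    simp at h
  have ha0 : a ≠ 0 := by
    rintro rfl
    simp [hx0.symm] at ha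
  have h1 : Ring.ordFrac A (algebraMap A K a) = 1 := by
    refine le_antisymm ?_ (Ring.ordFrac_ge_one_of_ne_zero ha0)
    rw [ha, map_inv₀]
    exact inv_le_one_of_one_le₀ h
  obtain ⟨u, rfl⟩ := Ring.isUnit_iff_ordFrac_one_of_isDiscreteValuationRing.2 h1
  refine ⟨↑u⁻¹, ?_⟩
  rw [← inv_inv x, ← ha]
  exact eq_inv_of_mul_eq_one_left (by rw [← map_mul, Units.inv_mul, map_one])

end Algebra

/-! ### Divisors on normal Noetherian schemes -/

section Normal

variable {X : Scheme.{u}} [IsIntegral X]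

/-- Every prime of the coordinate ring of an affine open subset comes from a point, whose
codimension is the height of the prime. -/
theorem exists_primeIdealOf_eq {X : Scheme.{u}} {U : X.Opens} (hU : IsAffineOpen U)
    (p : Ideal Γ(X, U)) (hp : p.IsPrime) :
    ∃ y : U, (hU.primeIdealOf y).asIdeal = p ∧ Order.coheight y.1 = p.height := by
  let q : Spec Γ(X, U) := ⟨p, hp⟩
  obtain ⟨y, hy⟩ : ∃ y : U, hU.primeIdealOf y = q :=
    ⟨hU.isoSpec.inv q, by
      change hU.isoSpec.hom (hU.isoSpec.inv q) = q
      simp⟩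
  refine ⟨y, by rw [hy], ?_⟩
  have h1 : Order.coheight (hU.fromSpec q) = Order.coheight q :=
    coheight_eq_of_isOpenImmersion hU.fromSpec
  rw [← hU.fromSpec_primeIdealOf y, hy, h1, ← idealHeight_eq_coheight]

theorem isIntegrallyClosed_of_isAffineOpen [∀ x : X, IsIntegrallyClosed (X.presheaf.stalk x)]
    {U : X.Opens} (hU : IsAffineOpen U) [Nonempty U] : IsIntegrallyClosed Γ(X, U) := by
  refine IsIntegrallyClosed.of_localization_maximal fun p _ hp => ?_
  obtain ⟨y, rfl, -⟩ := exists_primeIdealOf_eq hU p hp.isPrime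
  have := hU.isLocalization_stalk y
  exact IsIntegrallyClosed.of_equiv (IsLocalization.algEquiv (hU.primeIdealOf y).asIdeal.primeCompl
    (X.presheaf.stalk y.1) (Localization.AtPrime _)).toRingEquiv

variable [IsLocallyNoetherian X]

theorem isDiscreteValuationRing_stalk {x : X} [IsIntegrallyClosed (X.presheaf.stalk x)]
    (hx : Order.coheight x = 1) : IsDiscreteValuationRing (X.presheaf.stalk x) := by
  have : Ring.KrullDimLE 1 (X.presheaf.stalk x) := krullDimLE_of_coheight_le hx.le
  have hf : ¬ IsField (X.presheaf.stalk x) := by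
    intro h
    have := ringKrullDim_stalk_eq_coheight x
    rw [ringKrullDim_eq_zero_of_isField h, hx] at this
    exact absurd this (by simp)
  have : Ring.DimensionLEOne (X.presheaf.stalk x) := ⟨fun {p} hp hp' => hp'.isMaximal_of_ne_bot hp⟩
  have : IsDedekindDomain (X.presheaf.stalk x) := { }
  exact ((IsDiscreteValuationRing.TFAE _ hf).out 0 2).2 this

theorem ord_eq_zero_of_isUnit_stalk {x : X} {a : X.presheaf.stalk x} (ha : IsUnit a) :
    X.ord (algebraMap _ X.functionField a) x = 0 := by
  by_cases hx : Order.coheight x = 1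
  · have : Ring.KrullDimLE 1 (X.presheaf.stalk x) := krullDimLE_of_coheight_le hx.le
    have h0 : algebraMap _ X.functionField a ≠ 0 := (ha.map _).ne_zero
    rw [Scheme.ord_eq_iff hx h0]
    exact Ring.ordFrac_of_isUnit ha
  · exact Scheme.ord_eq_zero_of_coheight_neq_one hx _

theorem mem_range_stalk_of_ord_nonneg {x : X} [IsIntegrallyClosed (X.presheaf.stalk x)]
    (hx : Order.coheight x = 1) {g : X.functionField} (hg : 0 ≤ X.ord g x) :
    g ∈ (algebraMap (X.presheaf.stalk x) X.functionField).range := by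
  by_cases h0 : g = 0
  · exact ⟨0, by simp [h0]⟩
  have := isDiscreteValuationRing_stalk hx
  rw [Scheme.le_ord_iff hx h0] at hg
  exact mem_range_of_one_le_ordFrac hg

theorem mem_range_of_ord_nonneg [∀ x : X, IsIntegrallyClosed (X.presheaf.stalk x)]
    {U : X.Opens} (hU : IsAffineOpen U) [Nonempty U] {g : X.functionField}
    (hg : ∀ x ∈ U, Order.coheight x = 1 → 0 ≤ X.ord g x) :
    g ∈ (algebraMap Γ(X, U) X.functionField).range := by
  have := isIntegrallyClosed_of_isAffineOpen hU
  have : IsNoetherianRing Γ(X, U) := IsLocallyNoetherian.component_noetherian ⟨U, hU⟩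
  have := functionField_isFractionRing_of_isAffineOpen X U hU
  refine mem_range_algebraMap_of_height_one g fun p hp hp1 => ?_
  obtain ⟨y, rfl, hy⟩ := exists_primeIdealOf_eq hU p hp
  have := hU.isLocalization_stalk y
  rw [hp1] at hy
  obtain ⟨a, rfl⟩ := mem_range_stalk_of_ord_nonneg hy (hg _ y.2 hy)
  obtain ⟨⟨b, s⟩, hbs⟩ := IsLocalization.surj (hU.primeIdealOf y).asIdeal.primeCompl a
  have htower := functionField_isScalarTower X U y
  refine ⟨s, s.2, b, ?_⟩
  rw [Algebra.smul_def, IsScalarTower.algebraMap_apply Γ(X, U) (X.presheaf.stalk y.1)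
    X.functionField, IsScalarTower.algebraMap_apply Γ(X, U) (X.presheaf.stalk y.1)
    X.functionField, ← hbs, map_mul, mul_comm]

/-- A rational function without poles is a global section. -/
theorem exists_section_of_ord_nonneg [∀ x : X, IsIntegrallyClosed (X.presheaf.stalk x)]
    {g : X.functionField} (hg : ∀ x : X, Order.coheight x = 1 → 0 ≤ X.ord g x) :
    ∃ s : Γ(X, ⊤), X.presheaf.germ ⊤ (genericPoint X) (TopologicalSpace.Opens.mem_top _) s = g := by
  let ι := {U : X.affineOpens // Nonempty U.1}
  have h (U : ι) : ∃ s : Γ(X, U.1.1), X.germToFunctionField U.1.1 (h := U.2) s = g := by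
    have := U.2
    exact mem_range_of_ord_nonneg U.1.2 fun x _ => hg x
  choose s hs using h
  let V : ι → X.Opens := fun U => U.1.1
  have hmem (U : ι) : genericPoint X ∈ V U :=
    ((genericPoint_spec X).mem_open_set_iff (V U).isOpen).2 (by simpa using U.2)
  have hcompat : TopCat.Presheaf.IsCompatible X.presheaf V s := by
    intro U W
    have : Nonempty (V U ⊓ V W : X.Opens) := ⟨_, hmem U, hmem W⟩
    apply X.germToFunctionField_injective (V U ⊓ V W)
    simp only [Scheme.germToFunctionField] at hs ⊢
    rw [TopCat.Presheaf.germ_res_apply, TopCat.Presheaf.germ_res_apply]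
    exact (hs U).trans (hs W).symm
  obtain ⟨t, ht, -⟩ := X.sheaf.existsUnique_gluing V s hcompat
  have htop : (⊤ : X.Opens) ≤ iSup V := by
    intro x _
    obtain ⟨_, ⟨U, hU, rfl⟩, hxU, -⟩ :=
      X.isBasis_affineOpens.exists_subset_of_mem_open (Set.mem_univ x) isOpen_univ
    exact TopologicalSpace.Opens.mem_iSup.2 ⟨⟨⟨U, hU⟩, ⟨x, hxU⟩⟩, hxU⟩
  refine ⟨X.presheaf.map (homOfLE htop).op t, ?_⟩
  obtain ⟨U, -⟩ := TopologicalSpace.Opens.mem_iSup.1 (htop (TopologicalSpace.Opens.mem_top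
    (genericPoint X)))
  have h1 := TopCat.Presheaf.germ_res_apply X.presheaf (homOfLE htop) (genericPoint X)
    (TopologicalSpace.Opens.mem_top _) t
  have h2 := TopCat.Presheaf.germ_res_apply X.presheaf (TopologicalSpace.Opens.leSupr V U)
    (genericPoint X) (hmem U) t
  rw [← hs U, ← ht U]
  exact h1.trans h2.symm

end Normal

section Proper

variable {X : Scheme.{u}} [IsIntegral X] [IsLocallyNoetherian X]
  [∀ x : X, IsIntegrallyClosed (X.presheaf.stalk x)]

/-- A rational function with neither zeros nor poles is a unit in every local ring. -/
theorem exists_isUnit_stalk_of_ord_eq_zero {g : X.functionField} (hg0 : g ≠ 0)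
    (hg : ∀ x : X, Order.coheight x = 1 → X.ord g x = 0) (y : X) :
    ∃ a : X.presheaf.stalk y, IsUnit a ∧ algebraMap _ X.functionField a = g := by
  have hinv (x : X) : X.ord g⁻¹ x = - X.ord g x := by
    have h1 := Scheme.ord_mul (x := x) hg0 (inv_ne_zero hg0)
    have h2 := ord_eq_zero_of_isUnit_stalk (x := x) isUnit_one
    rw [map_one] at h2
    rw [mul_inv_cancel₀ hg0, h2] at h1
    omega
  obtain ⟨_, ⟨U, hU, rfl⟩, hyU, -⟩ :=
    X.isBasis_affineOpens.exists_subset_of_mem_open (Set.mem_univ y) isOpen_univ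
  have : Nonempty U := ⟨⟨y, hyU⟩⟩
  obtain ⟨s, hs⟩ := mem_range_of_ord_nonneg hU fun x _ hx => (hg x hx).ge
  obtain ⟨t, ht⟩ := mem_range_of_ord_nonneg hU (g := g⁻¹)
    fun x _ hx => by rw [hinv, hg x hx, neg_zero]
  have hst : s * t = 1 := by
    apply X.germToFunctionField_injective U
    rw [map_mul, map_one]
    exact (congrArg₂ (· * ·) hs ht).trans (mul_inv_cancel₀ hg0)
  refine ⟨X.presheaf.germ U y hyU s, (IsUnit.of_mul_eq_one t hst).map _, ?_⟩
  rw [Scheme.algebraMap_germ_eq_germToFunctionField]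
  exact hs

/-- On a normal scheme which is universally closed over a field, a rational function without poles
has no zeros. -/
theorem ord_eq_zero_of_ord_nonneg {k : Type u} [Field k] (s : X ⟶ Spec (CommRingCat.of k))
    [UniversallyClosed s] {g : X.functionField} (hg0 : g ≠ 0)
    (hg : ∀ x : X, Order.coheight x = 1 → 0 ≤ X.ord g x) (y : X) : X.ord g y = 0 := by
  obtain ⟨t, rfl⟩ := exists_section_of_ord_nonneg hg
  have ht : t ≠ 0 := by
    rintro rfl
    exact hg0 (map_zero _)
  obtain ⟨t', ht'⟩ := (isField_of_universallyClosed k s).mul_inv_cancel ht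
  have : Nonempty (⊤ : X.Opens) := ⟨⟨y, TopologicalSpace.Opens.mem_top y⟩⟩
  exact Scheme.ord_of_isUnit (.of_mul_eq_one t' ht') (TopologicalSpace.Opens.mem_top y)

end Proper

theorem IsProjectiveOver.isProper {k : Type u} [Field k] {X : Scheme.{u}}
    {s : X ⟶ Spec (CommRingCat.of k)} (h : IsProjectiveOver s) : IsProper s := by
  obtain ⟨n, i, hi, rfl⟩ := h
  have h0 : IsScalarTower k (stdGrading k n 0) (MvPolynomial (Fin (n + 1)) k) :=
    ⟨fun a b c => smul_assoc a (b : MvPolynomial (Fin (n + 1)) k) c⟩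
  have h1 : Algebra.FiniteType (stdGrading k n 0) (MvPolynomial (Fin (n + 1)) k) :=
    Algebra.FiniteType.of_restrictScalars_finiteType k _ _
  have h2 : Function.Surjective (algebraMap k (stdGrading k n 0)) := by
    rintro ⟨p, hp⟩
    have hp' : p.IsHomogeneous 0 := hp
    have := (MvPolynomial.totalDegree_eq_zero_iff_eq_C).1 (Nat.le_zero.1 hp'.totalDegree_le)
    exact ⟨p.coeff 0, Subtype.ext this.symm⟩
  have h3 : IsClosedImmersion
      (Spec.map (CommRingCat.ofHom (algebraMap k (stdGrading k n 0)))) :=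
    IsClosedImmersion.spec_of_surjective _ h2
  have h4 : IsProper (projSpaceHom k n) := by
    unfold projSpaceHom projSpace
    infer_instance
  infer_instance

section Birational

variable {X Y : Scheme.{u}} {f : X ⟶ Y}

theorem isIso_stalkMap_of_comp_isOpenImmersion {U : Scheme.{u}} (i : U ⟶ X) [IsOpenImmersion i]
    [IsOpenImmersion (i ≫ f)] (u : U) : IsIso (f.stalkMap (i u)) := by
  have h := Scheme.Hom.stalkMap_comp i f u
  have h0 : IsIso ((i ≫ f).stalkMap u) := inferInstance
  rw [h] at h0
  have : IsIso (f.stalkMap (i u) ≫ i.stalkMap u) := h0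
  exact IsIso.of_isIso_comp_right _ (i.stalkMap u)

/-- A birational morphism restricts to an open immersion on a nonempty open subset. -/
theorem IsBirationalMorphism.exists_isOpenImmersion [IsIntegral X] (h : IsBirationalMorphism f) :
    ∃ U : X.Opens, genericPoint X ∈ U ∧ IsOpenImmersion (U.ι ≫ f) := by
  obtain ⟨φ, hφ⟩ := h
  refine ⟨φ.source, ?_, ?_⟩
  · exact ((genericPoint_spec X).mem_open_set_iff φ.source.isOpen).2
      (by simpa using φ.dense_source.nonempty)
  · rw [← hφ]
    infer_instance

variable [IsIntegral X] [IsIntegral Y]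

theorem IsBirationalMorphism.map_genericPoint (h : IsBirationalMorphism f) :
    f (genericPoint X) = genericPoint Y := by
  obtain ⟨U, hU, hUf⟩ := h.exists_isOpenImmersion
  have : Nonempty U := ⟨_, hU⟩
  have h1 := genericPoint_eq_of_isOpenImmersion U.ι
  have h2 := genericPoint_eq_of_isOpenImmersion (U.ι ≫ f)
  rw [Scheme.Hom.comp_apply, h1] at h2
  exact h2

variable (f) in
/-- The map on function fields induced by a birational morphism. -/
noncomputable def functionFieldMap (h : f (genericPoint X) = genericPoint Y) :
    Y.functionField ⟶ X.functionField :=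
  Y.presheaf.stalkSpecializes (specializes_of_eq h) ≫ f.stalkMap (genericPoint X)

theorem IsBirationalMorphism.isIso_functionFieldMap (h : IsBirationalMorphism f) :
    IsIso (functionFieldMap f h.map_genericPoint) := by
  obtain ⟨U, hU, hUf⟩ := h.exists_isOpenImmersion
  have h1 : IsIso (f.stalkMap (genericPoint X)) :=
    isIso_stalkMap_of_comp_isOpenImmersion U.ι ⟨_, hU⟩
  have h2 : IsIso (Y.presheaf.stalkSpecializes (specializes_of_eq h.map_genericPoint)) :=
    (Y.presheaf.stalkCongr (Inseparable.of_eq h.map_genericPoint.symm)).isIso_hom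
  unfold functionFieldMap
  infer_instance

theorem stalkSpecializes_functionFieldMap (h : f (genericPoint X) = genericPoint Y) (x : X) :
    Y.presheaf.stalkSpecializes ((genericPoint_spec Y).specializes trivial) ≫ functionFieldMap f h =
      f.stalkMap x ≫ X.presheaf.stalkSpecializes ((genericPoint_spec X).specializes trivial) := by
  rw [functionFieldMap, ← Category.assoc, TopCat.Presheaf.stalkSpecializes_comp,
    ← Scheme.Hom.stalkSpecializes_stalkMap]

theorem functionFieldMap_algebraMap (h : f (genericPoint X) = genericPoint Y) (x : X)
    (a : Y.presheaf.stalk (f x)) :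
    (functionFieldMap f h).hom (algebraMap _ Y.functionField a) =
      algebraMap _ X.functionField ((f.stalkMap x).hom a) :=
  congr($(stalkSpecializes_functionFieldMap h x).hom a)

end Birational

section Codimension

variable {X Y : Scheme.{u}} [IsIntegral X] [IsIntegral Y] [IsLocallyNoetherian Y]
  [∀ y : Y, IsIntegrallyClosed (Y.presheaf.stalk y)] {f : X ⟶ Y}

omit [IsIntegral X] in
theorem valuationRing_stalk {y : Y} (hy : Order.coheight y ≤ 1) :
    ValuationRing (Y.presheaf.stalk y) := by
  by_cases h : Order.coheight y = 0
  · have : Ring.KrullDimLE 0 (Y.presheaf.stalk y) := krullDimLE_of_coheight_le h.le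
    let := (Ring.KrullDimLE.isField_of_isDomain (R := Y.presheaf.stalk y)).toField
    exact ValuationRing.of_field _
  · have := isDiscreteValuationRing_stalk (le_antisymm hy (Order.one_le_iff_ne_zero.2 h))
    infer_instance

theorem IsBirationalMorphism.bijective_stalkMap (h : IsBirationalMorphism f) {x : X}
    (hx : Order.coheight (f x) ≤ 1) : Function.Bijective (f.stalkMap x).hom := by
  have := valuationRing_stalk hx
  have := h.isIso_functionFieldMap
  exact bijective_of_valuationRing (f.stalkMap x).hom (functionFieldMap f h.map_genericPoint).hom
    (ConcreteCategory.bijective_of_isIso (functionFieldMap f h.map_genericPoint)).2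
    (functionFieldMap_algebraMap _ x)

theorem IsBirationalMorphism.coheight_eq (h : IsBirationalMorphism f) {x : X}
    (hx : Order.coheight (f x) ≤ 1) : Order.coheight x = Order.coheight (f x) := by
  have h1 := ringKrullDim_eq_of_ringEquiv
    (RingEquiv.ofBijective (f.stalkMap x).hom (h.bijective_stalkMap hx))
  rw [ringKrullDim_stalk_eq_coheight, ringKrullDim_stalk_eq_coheight] at h1
  exact_mod_cast h1.symm

theorem IsBirationalMorphism.ord_functionFieldMap [IsLocallyNoetherian X]
    (h : IsBirationalMorphism f) {x : X} (hx : Order.coheight (f x) = 1) {g : Y.functionField}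
    (hg : g ≠ 0) : X.ord ((functionFieldMap f h.map_genericPoint).hom g) x = Y.ord g (f x) := by
  have hx' : Order.coheight x = 1 := (h.coheight_eq hx.le).trans hx
  have := isDiscreteValuationRing_stalk hx
  have : Ring.KrullDimLE 1 (X.presheaf.stalk x) := krullDimLE_of_coheight_le hx'.le
  rw [Scheme.ord_eq_iff hx' (by simpa using hg)]
  refine (ordFrac_map_of_bijective (f.stalkMap x).hom (h.bijective_stalkMap hx.le)
    (functionFieldMap f h.map_genericPoint).hom (functionFieldMap_algebraMap _ x) g).trans ?_
  exact (Scheme.ord_eq_iff hx hg).1 rfl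

theorem IsBirationalMorphism.residueDegree_eq_one (h : IsBirationalMorphism f) {x : X}
    (hx : Order.coheight (f x) ≤ 1) : f.residueDegree x = 1 := by
  let := (f.residueFieldMap x).hom.toAlgebra
  change Module.finrank (Y.residueField (f x)) (X.residueField x) = 1
  have hs : Function.Surjective (f.residueFieldMap x).hom := by
    intro b
    obtain ⟨b, rfl⟩ := IsLocalRing.residue_surjective b
    obtain ⟨a, rfl⟩ := (h.bijective_stalkMap hx).2 b
    exact ⟨IsLocalRing.residue _ a, rfl⟩
  refine finrank_eq_one (1 : X.residueField x) one_ne_zero fun w => ?_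
  obtain ⟨c, rfl⟩ := hs w
  exact ⟨c, by rw [Algebra.smul_def, mul_one]; rfl⟩

omit [IsLocallyNoetherian Y] [∀ y : Y, IsIntegrallyClosed (Y.presheaf.stalk y)] in
theorem commSq_fromSpecStalk (h : f (genericPoint X) = genericPoint Y)
    [IsIso (functionFieldMap f h)] (y : Y) :
    CommSq (Spec.map (inv (functionFieldMap f h)) ≫ X.fromSpecStalk (genericPoint X))
      (Spec.map (CommRingCat.ofHom (algebraMap (Y.presheaf.stalk y) Y.functionField))) f
      (Y.fromSpecStalk y) where
  w := by
    have h1 : Spec.map (CommRingCat.ofHom (algebraMap (Y.presheaf.stalk y) Y.functionField)) ≫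
        Y.fromSpecStalk y = Y.fromSpecStalk (genericPoint Y) :=
      Scheme.SpecMap_stalkSpecializes_fromSpecStalk (genericPoint_specializes y)
    have h2 : Spec.map (functionFieldMap f h) ≫ Y.fromSpecStalk (genericPoint Y) =
        X.fromSpecStalk (genericPoint X) ≫ f := by
      rw [functionFieldMap, Spec.map_comp, Category.assoc,
        Scheme.SpecMap_stalkSpecializes_fromSpecStalk, Scheme.SpecMap_stalkMap_fromSpecStalk]
    refine Eq.trans ?_ h1.symm
    rw [Category.assoc, ← h2, ← Spec.map_comp_assoc, IsIso.hom_inv_id, Spec.map_id,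
      Category.id_comp]

theorem IsBirationalMorphism.exists_map_eq [UniversallyClosed f] (h : IsBirationalMorphism f)
    {y : Y} (hy : Order.coheight y ≤ 1) : ∃ x : X, f x = y := by
  have := valuationRing_stalk hy
  have := h.isIso_functionFieldMap
  have hex : ValuativeCriterion.Existence f :=
    (UniversallyClosed.eq_valuativeCriterion ▸ (inferInstance : UniversallyClosed f) :
      (ValuativeCriterion.Existence ⊓ @QuasiCompact) f).1
  let S : ValuativeCommSq f := ⟨Y.presheaf.stalk y, Y.functionField, _, _,
    commSq_fromSpecStalk h.map_genericPoint y⟩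
  obtain ⟨⟨l⟩⟩ := hex S
  refine ⟨l.l (IsLocalRing.closedPoint (Y.presheaf.stalk y)), ?_⟩
  have h1 : l.l ≫ f = Y.fromSpecStalk y := l.fac_right
  exact congr($h1 (IsLocalRing.closedPoint (Y.presheaf.stalk y))).trans
    Scheme.fromSpecStalk_closedPoint

theorem IsBirationalMorphism.eq_of_map_eq [IsSeparated f] (h : IsBirationalMorphism f)
    {x x' : X} (hx : Order.coheight (f x) ≤ 1) (hxx' : f x = f x') : x = x' := by
  obtain ⟨y, hy⟩ : ∃ y, f x' = y := ⟨_, rfl⟩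
  rw [hy] at hxx'
  have hval : ValuationRing (Y.presheaf.stalk y) := valuationRing_stalk (hxx' ▸ hx)
  have := h.isIso_functionFieldMap
  let S : ValuativeCommSq f := ⟨Y.presheaf.stalk y, Y.functionField, _, _,
    commSq_fromSpecStalk h.map_genericPoint y⟩
  have hlift (z : X) (hz : f z = y) :
      ∃ l : S.commSq.LiftStruct, l.l (IsLocalRing.closedPoint (Y.presheaf.stalk y)) = z := by
    subst hz
    have hb := h.bijective_stalkMap (x := z) (hxx' ▸ hx)
    have hiso : IsIso (f.stalkMap z) := (ConcreteCategory.isIso_iff_bijective _).2 hb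
    refine ⟨⟨Spec.map (inv (f.stalkMap z)) ≫ X.fromSpecStalk z, ?_, ?_⟩, ?_⟩
    · have h1 : Spec.map (X.presheaf.stalkSpecializes (genericPoint_specializes z)) ≫
          X.fromSpecStalk z = X.fromSpecStalk (genericPoint X) :=
        Scheme.SpecMap_stalkSpecializes_fromSpecStalk _
      change Spec.map (Y.presheaf.stalkSpecializes (genericPoint_specializes (f z))) ≫ _ =
        Spec.map (inv (functionFieldMap f h.map_genericPoint)) ≫ X.fromSpecStalk (genericPoint X)
      rw [← h1, ← Spec.map_comp_assoc, ← Spec.map_comp_assoc]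
      congr 2
      rw [IsIso.inv_comp_eq, ← Category.assoc, IsIso.eq_comp_inv]
      exact stalkSpecializes_functionFieldMap h.map_genericPoint z
    · change _ = Y.fromSpecStalk (f z)
      rw [Category.assoc, ← Scheme.SpecMap_stalkMap_fromSpecStalk, ← Spec.map_comp_assoc,
        IsIso.hom_inv_id, Spec.map_id]
      exact Category.id_comp (Y.fromSpecStalk (f z))
    · have : Spec.map (inv (f.stalkMap z)) (IsLocalRing.closedPoint (Y.presheaf.stalk (f z))) =
          IsLocalRing.closedPoint (X.presheaf.stalk z) :=
        IsLocalRing.comap_closedPoint (inv (f.stalkMap z)).hom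
      exact congr(X.fromSpecStalk z $this).trans Scheme.fromSpecStalk_closedPoint
  obtain ⟨l, hl⟩ := hlift x hxx'
  obtain ⟨l', hl'⟩ := hlift x' hy
  have := IsSeparated.valuativeCriterion f S
  rw [← hl, ← hl', Subsingleton.elim l l']

end Codimension

/-- In a Noetherian integral scheme, only finitely many points of codimension one lie outside a
given nonempty open subset. -/
theorem finite_coheight_eq_one_of_isOpen {X : Scheme.{u}} [IsIntegral X] [IsNoetherian X]
    {U : X.Opens} (hU : genericPoint X ∈ U) : {x : X | Order.coheight x = 1 ∧ x ∉ U}.Finite := by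
  obtain ⟨S, hS, hcl, hirr, hUS⟩ :=
    TopologicalSpace.NoetherianSpace.exists_finite_set_isClosed_irreducible
      (isClosed_compl_iff.2 U.isOpen)
  refine (hS.biUnion (t := fun T => {x | IsGenericPoint x T}) fun T _ => ?_).subset ?_
  · refine Set.Subsingleton.finite fun x hx y hy => ?_
    exact IsGenericPoint.eq hx hy
  · rintro x ⟨hx, hxU⟩
    have hxS : x ∈ ⋃₀ S := hUS ▸ hxU
    obtain ⟨T, hT, hxT⟩ := hxS
    obtain ⟨z, hz⟩ := QuasiSober.sober (hirr T hT) (hcl T hT)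
    have hzU : z ∉ U := by
      have : z ∈ (U : Set X)ᶜ := hUS ▸ ⟨T, hT, hz.mem⟩
      exact this
    have hxz : x ≤ z := hz.specializes hxT
    refine Set.mem_biUnion hT ?_
    by_cases hzx : z ≤ x
    · have : z = x := ((hz.specializes hxT).antisymm hzx).eq
      exact this ▸ hz
    have hlt : x < z := lt_of_le_not_ge hxz hzx
    have hzη : z < genericPoint X :=
      lt_of_le_not_ge (genericPoint_specializes z) fun h => hzU (h.mem_open U.isOpen hU)
    have h1 := Order.coheight_add_one_le hlt
    have h2 := Order.coheight_add_one_le hzη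
    rw [hx] at h1
    have h3 : (1 : ℕ∞) + 1 ≤ 1 := (add_le_add_left (le_trans le_add_self h2) 1).trans h1
    exact absurd h3 (by decide)

/-! ### Pushforward of divisors along a birational morphism -/

theorem divClass_sum_smul {X : Scheme.{u}} [IsIntegral X] [IsLocallyNoetherian X]
    (D : WeilDivisor X) : divClass D = D.sum fun P n => n • primeClass P := by
  change QuotientAddGroup.mk' (principalDivisors X) D = _
  conv_lhs => rw [← D.sum_single]
  rw [map_finsuppSum]
  refine Finsupp.sum_congr fun P _ => ?_
  rw [← mul_one (D P), ← smul_eq_mul, ← Finsupp.smul_single, map_zsmul]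
  simp [primeClass, divClass]

theorem divClass_eq_zero_iff {X : Scheme.{u}} [IsIntegral X] [IsLocallyNoetherian X]
    {D : WeilDivisor X} : divClass D = 0 ↔
      ∃ g : X.functionField, g ≠ 0 ∧ ∀ P : PrimeDivisor X, D P = X.ord g P.1 :=
  QuotientAddGroup.eq_zero_iff D

section Pushforward

variable {X Y : Scheme.{u}} {f : X ⟶ Y}

theorem pushforward_single (P : PrimeDivisor X) (n : ℤ) :
    pushforward f (Finsupp.single P n) = n • pushforwardPrime f P := by
  simp [pushforward]

theorem pushforwardPrime_of_mem_exceptionalPrimes {P : PrimeDivisor X}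
    (hP : P ∈ exceptionalPrimes f) : pushforwardPrime f P = 0 := by
  refine dif_neg fun h => ?_
  have hP' : 2 ≤ Order.coheight (f P.1) := hP
  rw [h] at hP'
  exact absurd hP' (by decide)

variable [IsIntegral X]

theorem IsBirationalMorphism.finite_exceptionalPrimes [IsNoetherian X]
    (h : IsBirationalMorphism f) : (exceptionalPrimes f).Finite := by
  obtain ⟨U, hU, hUf⟩ := h.exists_isOpenImmersion
  refine Set.Finite.of_finite_image
    ((finite_coheight_eq_one_of_isOpen hU).subset ?_) (f := Subtype.val) Subtype.val_injective.injOn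
  rintro _ ⟨P, hP, rfl⟩
  refine ⟨P.2, fun hPU => ?_⟩
  have hP' : 2 ≤ Order.coheight (f P.1) := hP
  have key (u : U.toScheme) : Order.coheight (f (U.ι u)) = Order.coheight (U.ι u) := by
    rw [coheight_eq_of_isOpenImmersion U.ι, ← Scheme.Hom.comp_apply,
      coheight_eq_of_isOpenImmersion (U.ι ≫ f)]
  have h1 : Order.coheight (f P.1) = Order.coheight P.1 := key ⟨P.1, hPU⟩
  rw [h1, P.2] at hP'
  exact absurd hP' (by decide)

theorem divClass_mem_exceptionalSubgroup [IsLocallyNoetherian X] {D : WeilDivisor X}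
    (hD : ∀ P, P ∉ exceptionalPrimes f → D P = 0) : divClass D ∈ exceptionalSubgroup f := by
  rw [divClass_sum_smul]
  refine AddSubgroup.sum_mem _ fun P hP => AddSubgroup.zsmul_mem _ ?_ _
  refine AddSubgroup.subset_closure ⟨P, ?_, rfl⟩
  by_contra hPe
  exact Finsupp.mem_support_iff.1 hP (hD P hPe)

variable [IsIntegral Y] [IsLocallyNoetherian Y]
  [∀ y : Y, IsIntegrallyClosed (Y.presheaf.stalk y)]

theorem IsBirationalMorphism.exists_map_eq_of_notMem (h : IsBirationalMorphism f)
    {P : PrimeDivisor X} (hP : P ∉ exceptionalPrimes f) : ∃ Q : PrimeDivisor Y, f P.1 = Q.1 := by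
  have hP' : Order.coheight (f P.1) ≤ 1 := by
    have hlt : Order.coheight (f P.1) < 1 + 1 := not_le.1 hP
    exact Order.le_of_lt_add_one hlt
  exact ⟨⟨f P.1, (h.coheight_eq hP').symm.trans P.2⟩, rfl⟩

theorem IsBirationalMorphism.exists_primeDivisor [UniversallyClosed f] (h : IsBirationalMorphism f)
    (Q : PrimeDivisor Y) : ∃ P : PrimeDivisor X, f P.1 = Q.1 := by
  obtain ⟨x, hx⟩ := h.exists_map_eq Q.2.le
  have hx1 : Order.coheight (f x) = 1 := hx ▸ Q.2
  exact ⟨⟨x, (h.coheight_eq hx1.le).trans hx1⟩, hx⟩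

theorem IsBirationalMorphism.pushforwardPrime_eq (h : IsBirationalMorphism f) {P : PrimeDivisor X}
    {Q : PrimeDivisor Y} (hPQ : f P.1 = Q.1) : pushforwardPrime f P = Finsupp.single Q 1 := by
  have hP : Order.coheight (f P.1) = 1 := hPQ ▸ Q.2
  have hQ : (⟨f P.1, hP⟩ : PrimeDivisor Y) = Q := Subtype.ext hPQ
  rw [pushforwardPrime, dif_pos hP, h.residueDegree_eq_one hP.le, hQ, Nat.cast_one]

/-- The coefficient of the pushforward at the image of a prime divisor. -/
theorem IsBirationalMorphism.pushforward_apply [IsSeparated f] (h : IsBirationalMorphism f)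
    (D : WeilDivisor X) {P : PrimeDivisor X} {Q : PrimeDivisor Y} (hPQ : f P.1 = Q.1) :
    pushforward f D Q = D P := by
  induction D using Finsupp.induction_linear with
  | zero => rw [map_zero]; rfl
  | add D E hD hE => rw [map_add, Finsupp.add_apply, hD, hE, Finsupp.add_apply]
  | single P' n =>
    rw [pushforward_single, Finsupp.smul_apply]
    by_cases hP' : P' ∈ exceptionalPrimes f
    · have hne : P' ≠ P := by
        rintro rfl
        have hP2 : 2 ≤ Order.coheight (f P'.1) := hP'
        rw [hPQ, Q.2] at hP2
        exact absurd hP2 (by decide)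
      rw [pushforwardPrime_of_mem_exceptionalPrimes hP', Finsupp.single_eq_of_ne' hne]
      exact smul_zero n
    · obtain ⟨Q', hQ'⟩ := h.exists_map_eq_of_notMem hP'
      rw [h.pushforwardPrime_eq hQ']
      by_cases hPP : P' = P
      · subst hPP
        have hQQ : Q' = Q := Subtype.ext (hQ'.symm.trans hPQ)
        rw [hQQ, Finsupp.single_eq_same, Finsupp.single_eq_same, smul_eq_mul, mul_one]
      · have hne : Q' ≠ Q := by
          rintro rfl
          exact hPP (Subtype.ext (h.eq_of_map_eq (hQ' ▸ Q'.2.le) (hQ'.trans hPQ.symm)))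
        rw [Finsupp.single_eq_of_ne' hne, Finsupp.single_eq_of_ne' hPP, smul_zero]

theorem IsBirationalMorphism.pushforward_nonneg [IsProper f] (h : IsBirationalMorphism f)
    {D : WeilDivisor X} (hD : 0 ≤ D) : 0 ≤ pushforward f D := by
  intro Q
  obtain ⟨P, hP⟩ := h.exists_primeDivisor Q
  rw [h.pushforward_apply D hP]
  exact hD P

theorem IsBirationalMorphism.pushforward_surjective [IsProper f] (h : IsBirationalMorphism f) :
    Function.Surjective (pushforward f) := by
  intro E
  induction E using Finsupp.induction_linear with
  | zero => exact ⟨0, map_zero _⟩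
  | add E E' hE hE' =>
    obtain ⟨D, rfl⟩ := hE
    obtain ⟨D', rfl⟩ := hE'
    exact ⟨D + D', map_add _ _ _⟩
  | single Q n =>
    obtain ⟨P, hP⟩ := h.exists_primeDivisor Q
    refine ⟨Finsupp.single P n, ?_⟩
    rw [pushforward_single, h.pushforwardPrime_eq hP, Finsupp.smul_single, smul_eq_mul, mul_one]

variable [IsLocallyNoetherian X]

/-- The pushforward of the divisor of a rational function. -/
theorem IsBirationalMorphism.exists_ord_eq [IsProper f] (h : IsBirationalMorphism f)
    {D : WeilDivisor X} {g : X.functionField} (hg : g ≠ 0)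
    (hD : ∀ P : PrimeDivisor X, D P = X.ord g P.1) :
    ∃ g' : Y.functionField, g' ≠ 0 ∧ (functionFieldMap f h.map_genericPoint).hom g' = g ∧
      ∀ Q : PrimeDivisor Y, pushforward f D Q = Y.ord g' Q.1 := by
  have := h.isIso_functionFieldMap
  obtain ⟨g', rfl⟩ :=
    (ConcreteCategory.bijective_of_isIso (functionFieldMap f h.map_genericPoint)).2 g
  have hg' : g' ≠ 0 := by
    rintro rfl
    exact hg (map_zero _)
  refine ⟨g', hg', rfl, fun Q => ?_⟩
  obtain ⟨P, hP⟩ := h.exists_primeDivisor Q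
  rw [h.pushforward_apply D hP, hD, ← hP]
  exact h.ord_functionFieldMap (hP ▸ Q.2) hg'

/-- A divisor whose pushforward is principal is equivalent to an exceptional divisor. -/
theorem IsBirationalMorphism.divClass_mem_exceptionalSubgroup_of_pushforward [IsProper f]
    (h : IsBirationalMorphism f) (hfin : (exceptionalPrimes f).Finite) {D : WeilDivisor X}
    (hD : divClass (pushforward f D) = 0) : divClass D ∈ exceptionalSubgroup f := by
  classical
  obtain ⟨g', hg', hDg⟩ := divClass_eq_zero_iff.1 hD
  let g := (functionFieldMap f h.map_genericPoint).hom g'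
  have hg : g ≠ 0 := by simpa [g] using hg'
  let E : WeilDivisor X := Finsupp.onFinset hfin.toFinset
    (fun P => if P ∈ exceptionalPrimes f then D P - X.ord g P.1 else 0) (by simp +contextual)
  have hE (P : PrimeDivisor X) :
    E P = if P ∈ exceptionalPrimes f then D P - X.ord g P.1 else 0 := rfl
  have hDE : divClass (D - E) = 0 := by
    refine divClass_eq_zero_iff.2 ⟨g, hg, fun P => ?_⟩
    rw [Finsupp.sub_apply, hE]
    split_ifs with hP
    · exact sub_sub_cancel _ _
    · obtain ⟨Q, hQ⟩ := h.exists_map_eq_of_notMem hP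
      rw [sub_zero, ← h.pushforward_apply D hQ, hDg, ← hQ]
      exact (h.ord_functionFieldMap (hQ ▸ Q.2) hg').symm
  have : divClass D = divClass E := sub_eq_zero.1 hDE
  rw [this]
  exact divClass_mem_exceptionalSubgroup fun P hP => by rw [hE, if_neg hP]

/-- The pushforward of divisor classes. -/
noncomputable def IsBirationalMorphism.classPushforward [IsProper f] (h : IsBirationalMorphism f) :
    Cl X →+ Cl Y :=
  QuotientAddGroup.map _ _ (pushforward f) fun D hD => by
    obtain ⟨g, hg, hDg⟩ := hD
    obtain ⟨g', hg', -, hDg'⟩ := h.exists_ord_eq hg hDg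
    exact ⟨g', hg', hDg'⟩

theorem IsBirationalMorphism.classPushforward_divClass [IsProper f] (h : IsBirationalMorphism f)
    (D : WeilDivisor X) : h.classPushforward (divClass D) = divClass (pushforward f D) := rfl

theorem IsBirationalMorphism.classPushforward_surjective [IsProper f]
    (h : IsBirationalMorphism f) : Function.Surjective h.classPushforward := by
  intro c
  obtain ⟨E, rfl⟩ := QuotientAddGroup.mk_surjective c
  obtain ⟨D, rfl⟩ := h.pushforward_surjective E
  exact ⟨divClass D, rfl⟩

theorem IsBirationalMorphism.ker_classPushforward [IsProper f] (h : IsBirationalMorphism f)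
    (hfin : (exceptionalPrimes f).Finite) : h.classPushforward.ker = exceptionalSubgroup f := by
  refine le_antisymm (fun c hc => ?_) ((AddSubgroup.closure_le _).2 ?_)
  · obtain ⟨D, rfl⟩ := QuotientAddGroup.mk_surjective c
    exact h.divClass_mem_exceptionalSubgroup_of_pushforward hfin hc
  · rintro _ ⟨P, hP, rfl⟩
    change divClass (pushforward f (Finsupp.single P 1)) = 0
    rw [pushforward_single, pushforwardPrime_of_mem_exceptionalPrimes hP, smul_zero]
    rfl

/-- The classes of the exceptional prime divisors are linearly independent. -/
theorem IsBirationalMorphism.linearIndependent_primeClass [IsProper f]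
    (h : IsBirationalMorphism f) :
    LinearIndependent ℤ fun E : exceptionalPrimes f => primeClass E.1 := by
  rw [linearIndependent_iff]
  intro l hl
  let D : WeilDivisor X := l.embDomain (Function.Embedding.subtype _)
  have hcl : divClass D = 0 := by
    rw [divClass_sum_smul, Finsupp.sum_embDomain]
    exact hl
  have hpush : pushforward f D = 0 := by
    rw [← D.sum_single, map_finsuppSum, Finsupp.sum_embDomain]
    refine Finset.sum_eq_zero fun P _ => ?_
    refine (pushforward_single P.1 (l P)).trans ?_
    rw [pushforwardPrime_of_mem_exceptionalPrimes P.2, smul_zero]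
  obtain ⟨g, hg, hDg⟩ := divClass_eq_zero_iff.1 hcl
  obtain ⟨g', hg', rfl, hDg'⟩ := h.exists_ord_eq hg hDg
  have hord (y : Y) (hy : Order.coheight y = 1) : Y.ord g' y = 0 := by
    have := hDg' ⟨y, hy⟩
    rw [hpush] at this
    exact this.symm
  ext P
  have hP : l P = D P.1 := (Finsupp.embDomain_apply_self _ l P).symm
  obtain ⟨a, ha, rfl⟩ := exists_isUnit_stalk_of_ord_eq_zero hg' hord (f P.1.1)
  rw [hP, hDg, functionFieldMap_algebraMap]
  exact ord_eq_zero_of_isUnit_stalk (ha.map _)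

/-- An effective divisor class with a multiple in the subgroup generated by the exceptional prime
divisors lies in that subgroup. -/
theorem IsBirationalMorphism.mem_exceptionalSubgroup_of_isEffectiveClass [IsProper f]
    (h : IsBirationalMorphism f) (hfin : (exceptionalPrimes f).Finite) {k : Type u} [Field k]
    (s : Y ⟶ Spec (CommRingCat.of k)) [UniversallyClosed s] {c : Cl X} (hc : IsEffectiveClass c)
    {m : ℕ} (hm : 0 < m) (hmc : m • c ∈ exceptionalSubgroup f) : c ∈ exceptionalSubgroup f := by
  obtain ⟨D, hD, rfl⟩ := hc
  rw [← h.ker_classPushforward hfin, AddMonoidHom.mem_ker] at hmc ⊢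
  have hmD : divClass (m • pushforward f D) = 0 := by
    rw [map_nsmul] at hmc
    exact hmc
  obtain ⟨g, hg, hDg⟩ := divClass_eq_zero_iff.1 hmD
  have hnn := h.pushforward_nonneg hD
  have hnn' (Q : PrimeDivisor Y) : 0 ≤ Y.ord g Q.1 := by
    rw [← hDg Q, Finsupp.smul_apply]
    exact nsmul_nonneg (hnn Q) m
  have hord := ord_eq_zero_of_ord_nonneg s hg fun y hy => hnn' ⟨y, hy⟩
  have hpush : pushforward f D = 0 := by
    ext Q
    have := hDg Q
    rw [hord, Finsupp.smul_apply] at this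
    exact (smul_eq_zero.1 this).resolve_left hm.ne'
  rw [h.classPushforward_divClass, hpush]
  rfl

end Pushforward

/-- A class with a positive multiple that is a nonnegative combination of prime divisors lies in the
effective cone. -/
theorem one_tmul_mem_effectiveCone {X : Scheme.{u}} [IsIntegral X] [IsLocallyNoetherian X]
    {S : Set (PrimeDivisor X)} {c : Cl X} {m : ℕ} (hm : 0 < m)
    (hmc : m • c ∈ AddSubmonoid.closure (primeClass '' S)) :
    (1 : ℝ) ⊗ₜ[ℤ] c ∈ effectiveCone X := by
  have key (d : Cl X) (hd : d ∈ AddSubmonoid.closure (primeClass '' S)) :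
      (1 : ℝ) ⊗ₜ[ℤ] d ∈ effectiveCone X := by
    induction hd using AddSubmonoid.closure_induction with
    | mem x hx =>
      obtain ⟨P, -, rfl⟩ := hx
      exact Submodule.subset_span ⟨P, rfl⟩
    | zero =>
      rw [TensorProduct.tmul_zero]
      exact zero_mem _
    | add x y _ _ hx hy =>
      rw [TensorProduct.tmul_add]
      exact add_mem hx hy
  have h1 := key _ hmc
  rw [TensorProduct.tmul_smul] at h1
  have h2 := (effectiveCone X).smul_mem (inv_nonneg.2 (Nat.cast_nonneg (α := ℝ) m)) h1
  rwa [← Nat.cast_smul_eq_nsmul ℝ, smul_smul, inv_mul_cancel₀ (by positivity), one_smul] at h2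

end TorsionHoles

theorem mainTheorem5 {k : Type u} [Field k] (X Y : TorsionHoles.NormalProjectiveVariety k)
    (f : X.carrier ⟶ Y.carrier) (hf : f ≫ Y.hom = X.hom)
    (hbir : TorsionHoles.IsBirationalMorphism f) :
    -- there are finitely many prime exceptional divisors, and the sum of the `ℤ[E]` is direct
    (TorsionHoles.exceptionalPrimes f).Finite ∧
    LinearIndependent ℤ
      (fun E : TorsionHoles.exceptionalPrimes f => TorsionHoles.primeClass E.1) ∧
    -- the pushforward induces an isomorphism `Cl(X) / H ≃ Cl(Y)`
    (∃ e : (TorsionHoles.Cl X.carrier ⧸ TorsionHoles.exceptionalSubgroup f) ≃+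
        TorsionHoles.Cl Y.carrier,
      ∀ D : TorsionHoles.WeilDivisor X.carrier,
        e (QuotientAddGroup.mk (TorsionHoles.divClass D)) =
          TorsionHoles.divClass (TorsionHoles.pushforward f D)) ∧
    -- if `H` is not saturated, then `Cl(Y)` has torsion
    (¬ (TorsionHoles.exceptionalSubgroup f).toAddSubmonoid.NSMulSaturated →
      ∃ c : TorsionHoles.Cl Y.carrier, c ≠ 0 ∧ IsOfFinAddOrder c) ∧
    -- a class outside `H` with a multiple in `H` is not effective, and pushes forward to a
    -- nonzero torsion class
    (∀ D : TorsionHoles.WeilDivisor X.carrier,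
      TorsionHoles.divClass D ∉ TorsionHoles.exceptionalSubgroup f →
      (∃ m : ℕ, 0 < m ∧ m • TorsionHoles.divClass D ∈ TorsionHoles.exceptionalSubgroup f) →
        ¬ TorsionHoles.IsEffectiveClass (TorsionHoles.divClass D) ∧
        TorsionHoles.divClass (TorsionHoles.pushforward f D) ≠ 0 ∧
        IsOfFinAddOrder (TorsionHoles.divClass (TorsionHoles.pushforward f D))) ∧
    -- it is a hole if some multiple is a nonnegative combination of the `[E]`
    (∀ D : TorsionHoles.WeilDivisor X.carrier,
      TorsionHoles.divClass D ∉ TorsionHoles.exceptionalSubgroup f →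
      (∃ m : ℕ, 0 < m ∧ m • TorsionHoles.divClass D ∈
        AddSubmonoid.closure (TorsionHoles.primeClass '' TorsionHoles.exceptionalPrimes f)) →
        TorsionHoles.IsHole (TorsionHoles.divClass D)) := by
  have hYn := Y.isNormal
  have hXp : IsProper X.hom := X.isProjective.isProper
  have hYp : IsProper Y.hom := Y.isProjective.isProper
  have hfp : IsProper f := by
    have : IsProper (f ≫ Y.hom) := hf ▸ hXp
    exact IsProper.of_comp f Y.hom
  have : CompactSpace X.carrier := (quasiCompact_iff_compactSpace X.hom).1 inferInstance
  have : IsNoetherian X.carrier := { }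
  have hfin := hbir.finite_exceptionalPrimes
  have hker := hbir.ker_classPushforward hfin
  have htor (c : TorsionHoles.Cl X.carrier) (hc : c ∉ TorsionHoles.exceptionalSubgroup f) (m : ℕ)
      (hm : 0 < m) (hmc : m • c ∈ TorsionHoles.exceptionalSubgroup f) :
      hbir.classPushforward c ≠ 0 ∧ IsOfFinAddOrder (hbir.classPushforward c) := by
    rw [← hker, AddMonoidHom.mem_ker] at hc hmc
    exact ⟨hc, isOfFinAddOrder_iff_nsmul_eq_zero.2 ⟨m, hm, by rw [← map_nsmul, hmc]⟩⟩
  have hneff (c : TorsionHoles.Cl X.carrier) (hc : c ∉ TorsionHoles.exceptionalSubgroup f) (m : ℕ)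
      (hm : 0 < m) (hmc : m • c ∈ TorsionHoles.exceptionalSubgroup f) :
      ¬ TorsionHoles.IsEffectiveClass c := fun heff =>
    hc (hbir.mem_exceptionalSubgroup_of_isEffectiveClass hfin Y.hom heff hm hmc)
  refine ⟨hfin, hbir.linearIndependent_primeClass, ?_, ?_, ?_, ?_⟩
  · exact ⟨(QuotientAddGroup.quotientAddEquivOfEq hker.symm).trans
      (QuotientAddGroup.quotientKerEquivOfSurjective _ hbir.classPushforward_surjective),
      fun D => rfl⟩
  · intro hsat
    simp only [AddSubmonoid.NSMulSaturated, not_forall, not_or] at hsat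
    obtain ⟨m, c, hmc, hm, hc⟩ := hsat
    exact ⟨_, htor c hc m (Nat.pos_of_ne_zero hm) hmc⟩
  · rintro D hD ⟨m, hm, hmD⟩
    exact ⟨hneff _ hD m hm hmD, htor _ hD m hm hmD⟩
  · rintro D hD ⟨m, hm, hmD⟩
    refine ⟨TorsionHoles.one_tmul_mem_effectiveCone hm hmD, hneff _ hD m hm ?_⟩
    exact (AddSubmonoid.closure_le (S := (TorsionHoles.exceptionalSubgroup f).toAddSubmonoid)).2
      AddSubgroup.subset_closure hmD
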